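/- Let $K:[a,b]\times[c,d]\to\mathbb R$ ($a<b$, $c<d$) be a continuous real kernel. Its singular values $\sigma_1\ge\sigma_2\ge\cdots\ge 0$ are the numbers $\sigma_n>0$, listed in non-increasing order with multiplicity (and $\sigma_n=0$ beyond the number of positive ones), for which there are orthonormal functions $u_n\in L^2([a,b])$, $v_n\in L^2([c,d])$ with $$\sigma_n u_n(x)=\int_c^d K(x,y)v_n(y)\,dy,\qquad \sigma_n v_n(y)=\int_a^b K(x,y)u_n(x)\,dx \quad\text{(a.e.)}.$$ Let $r\ge 0$ be an integer and $V\ge 0$ a real number. Say that a function $f$ on a compact interval has property $(r,V)$ if $f$ is $(r-1)$-times continuously differentiable and its $r$-th derivative has total variation at most $V$. Here, for $r=0$, this means that $f$ is continuous with total variation at most $V$; for $r\ge1$ the $r$-th derivative is a weak derivative, i.e. $f\in C^{r-1}$ and $f^{(r-1)}$ is a primitive of a function $g$ of total variation at most $V$. For integers $k>r+1$ put $$B_{r,V}(k)=\frac{2V\,\bigl(\pi(r+\tfrac12)\bigr)^{-1/2}}{\sqrt k\,(k-r-1)^{r+1/2}};$$ then $B_{r,V}(k)=\mathcal O(k^{-(r+1)})$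 as $k\to\infty$, and the following hold. 1. If $[a,b]=[c,d]=[-1,1]$ and $K(\cdot,y)$ has property $(r,V)$ for every $y\in[-1,1]$, then $\sigma_{2k}\le B_{r,V}(k)$ for all integers $k>r+1$, and $\sigma_n=\mathcal O(n^{-(r+1)})$ as $n\to\infty$. The same conclusion holds if instead $K(x,\cdot)$ has property $(r,V)$ for every $x\in[-1,1]$. 2. On a general rectangle, if $K(\cdot,y)$ has property $(r,V)$ on $[a,b]$ for every $y\in[c,d]$, then $$\sigma_{2k}\le \frac{\sqrt{(b-a)(d-c)}}{2}\Bigl(\frac{b-a}{2}\Bigr)^{r}B_{r,V}(k)\qquad\text{for all integers } k>r+1,$$ and $\sigma_n=\mathcal O(n^{-(r+1)})$. If instead $K(x,\cdot)$ has property $(r,V)$ on $[c,d]$ for every $x\in[a,b]$, then the same holds with $\bigl(\frac{b-a}{2}\bigr)^{r}$ replaced by $\bigl(\frac{d-c}{2}\bigr)^{r}$. -/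

import Mathlib

open Set Filter MeasureTheory
open scoped NNReal ENNReal Topology

noncomputable section

/-- The real Hilbert space `L²([a,b])` with respect to Lebesgue measure. -/
abbrev L2Icc (a b : ℝ) : Type := Lp ℝ 2 (volume.restrict (Icc a b))

/-- `σ i > 0` are singular values of the kernel `K : [a,b] × [c,d] → ℝ` with right singular
functions `u i` (orthonormal in `L²([a,b])`) and left singular functions `v i` (orthonormal in
`L²([c,d])`):
`σ i * u i x = ∫_c^d K(x,y) v i y dy` and `σ i * v i y = ∫_a^b K(x,y) u i x dx`,
the equalities holding almost everywhere. -/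
structure IsSingularSystem (a b c d : ℝ) (K : ℝ → ℝ → ℝ) {ι : Type*}
    (σ : ι → ℝ) (u : ι → L2Icc a b) (v : ι → L2Icc c d) : Prop where
  pos : ∀ i, 0 < σ i
  orthonormal_right : Orthonormal ℝ u
  orthonormal_left : Orthonormal ℝ v
  right_eq : ∀ i, ∀ᵐ x ∂(volume.restrict (Icc a b)),
    σ i * u i x = ∫ y in Icc c d, K x y * v i y
  left_eq : ∀ i, ∀ᵐ y ∂(volume.restrict (Icc c d)),
    σ i * v i y = ∫ x in Icc a b, K x y * u i x

/-- The `n`-th singular value `σ_n` (`n ≥ 1`) of the kernel `K` on `[a,b] × [c,d]`, where the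
singular values are listed in non-increasing order and repeated according to multiplicity:
the largest `s > 0` such that there are `n` orthonormal pairs of singular functions whose
singular values are all `≥ s`, and `0` if `K` has fewer than `n` positive singular values.
(The value at `n = 0` is meaningless.) -/
def singularValue (a b c d : ℝ) (K : ℝ → ℝ → ℝ) (n : ℕ) : ℝ :=
  sSup (insert 0 {s : ℝ | ∃ (σ : Fin n → ℝ) (u : Fin n → L2Icc a b) (v : Fin n → L2Icc c d),
    IsSingularSystem a b c d K σ u v ∧ ∀ i, s ≤ σ i})

/-- The set of which `singularValue` is the supremum is bounded above. -/
theorem bddAbove_singularValue_set {a b c d : ℝ} {K : ℝ → ℝ → ℝ}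
    (hK : ContinuousOn (Function.uncurry K) (Icc a b ×ˢ Icc c d)) {n : ℕ} (hn : 1 ≤ n) :
    BddAbove (insert 0 {s : ℝ | ∃ (σ : Fin n → ℝ) (u : Fin n → L2Icc a b)
      (v : Fin n → L2Icc c d),
      IsSingularSystem a b c d K σ u v ∧ ∀ i, s ≤ σ i}) := by
  obtain ⟨M, hM⟩ := (isCompact_Icc.prod isCompact_Icc).exists_bound_of_continuousOn hK
  rw [bddAbove_insert]
  set C : ℝ := ∫ _ in Icc c d, (1 : ℝ)
  refine ⟨(measureUnivNNReal (volume.restrict (Icc a b)) : ℝ) ^ (2 : ℝ≥0∞).toReal⁻¹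
    * (|M| * (C + 1)), ?_⟩
  rintro s ⟨σ, u, v, h, hs⟩
  have i : Fin n := ⟨0, hn⟩
  have hv1 : ‖v i‖ = 1 := h.orthonormal_left.1 i
  have hu1 : ‖u i‖ = 1 := h.orthonormal_right.1 i
  have hsq : ∫ y in Icc c d, v i y * v i y = 1 := by
    have := L2.inner_def (𝕜 := ℝ) (v i) (v i)
    rw [real_inner_self_eq_norm_sq, hv1] at this
    simpa [pow_two] using this.symm
  have hint : Integrable (fun y => v i y * v i y) (volume.restrict (Icc c d)) := by
    have := L2.integrable_inner (𝕜 := ℝ) (v i) (v i)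
    simpa [pow_two] using this
  have hC : 0 ≤ C := by positivity
  have hnorm : ‖σ i • u i‖ = σ i := by
    rw [norm_smul, hu1, mul_one, Real.norm_of_nonneg (h.pos i).le]
  refine (hs i).trans ?_
  rw [← hnorm]
  refine Lp.norm_le_of_ae_bound (by positivity) ?_
  filter_upwards [h.right_eq i, Lp.coeFn_smul (σ i) (u i), ae_restrict_mem measurableSet_Icc]
    with x hx hsm hxI
  rw [hsm, Pi.smul_apply, smul_eq_mul, hx]
  calc ‖∫ y in Icc c d, K x y * v i y‖
      ≤ ∫ y in Icc c d, |M| * (1 + v i y * v i y) := by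
        refine norm_integral_le_of_norm_le ((((integrable_const _).add hint)).const_mul _) ?_
        filter_upwards [ae_restrict_mem measurableSet_Icc] with y hy
        rw [norm_mul]
        have h1 : ‖K x y‖ ≤ |M| := (hM (x, y) ⟨hxI, hy⟩).trans (le_abs_self M)
        have h2 : ‖v i y‖ ≤ 1 + v i y * v i y := by
          rw [Real.norm_eq_abs]
          rcases abs_cases (v i y) with ⟨he, _⟩ | ⟨he, _⟩ <;> rw [he] <;>
            nlinarith [sq_nonneg (v i y - 1), sq_nonneg (v i y + 1)]
        gcongr
    _ = |M| * (C + 1) := by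
        rw [integral_const_mul, integral_add (integrable_const _) hint, hsq]

/-- In every singular value expansion of a continuous kernel, the `n`-th term of the non-increasing
list `σ_1 ≥ σ_2 ≥ ⋯ > 0` is at most `singularValue a b c d K n`. -/
theorem IsSingularSystem.le_singularValue {a b c d : ℝ} {K : ℝ → ℝ → ℝ}
    (hK : ContinuousOn (Function.uncurry K) (Icc a b ×ˢ Icc c d)) {n : ℕ} (hn : 1 ≤ n)
    {σ : Fin n → ℝ} {u : Fin n → L2Icc a b} {v : Fin n → L2Icc c d}
    (h : IsSingularSystem a b c d K σ u v) {s : ℝ} (hs : ∀ i, s ≤ σ i) :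
    s ≤ singularValue a b c d K n :=
  le_csSup (bddAbove_singularValue_set hK hn) (Or.inr ⟨σ, u, v, h, hs⟩)

/-- `f : [a,b] → ℝ` is `(r-1)`-times continuously differentiable and its `r`-th derivative has
(total) variation at most `V` on `[a,b]`. For `r = 0`: `f` is continuous with variation at most `V`.
For `r = m + 1` the `r`-th derivative is understood in the weak sense: it is a function `g` of
variation at most `V` of which `f^(m)` is a primitive
(so that, for example, `|x|` on `[-1,1]` qualifies with `r = 1`, `V = 2`). -/
def HasDerivOfVariationLE (a b : ℝ) (V : ℝ≥0) : ℕ → (ℝ → ℝ) → Prop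
  | 0, f => ContinuousOn f (Icc a b) ∧ eVariationOn f (Icc a b) ≤ (V : ℝ≥0∞)
  | m + 1, f => ContDiffOn ℝ (m : ℕ) f (Icc a b) ∧
      ∃ g : ℝ → ℝ, eVariationOn g (Icc a b) ≤ (V : ℝ≥0∞) ∧
        ∀ x ∈ Icc a b, iteratedDerivWithin m f (Icc a b) x =
          iteratedDerivWithin m f (Icc a b) a + ∫ t in a..x, g t

/-- The number `2 V (π (r + 1/2))^(-1/2) / (√k (k - r - 1)^(r + 1/2))`. -/
def decayBound (r : ℕ) (V : ℝ≥0) (k : ℕ) : ℝ :=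
  2 * (V : ℝ) * (Real.pi * ((r : ℝ) + 1 / 2)) ^ (-(1 / 2) : ℝ) /
    (√(k : ℝ) * ((k : ℝ) - (r : ℝ) - 1) ^ ((r : ℝ) + 1 / 2))

end

theorem exists_abs_sub_le_half {S : Set ℝ} (hS : S.Nonempty) {v : ℝ}
    (h : ∀ x ∈ S, ∀ y ∈ S, x - y ≤ v) : ∃ c, ∀ x ∈ S, |x - c| ≤ v / 2 := by
  obtain ⟨z, hz⟩ := hS
  have hb : BddAbove S := ⟨z + v, fun x hx => by linarith [h x hx z hz]⟩
  refine ⟨sSup S - v / 2, fun x hx => abs_le.2 ⟨?_, ?_⟩⟩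
  · have : sSup S ≤ x + v := csSup_le ⟨z, hz⟩ fun y hy => by linarith [h y hy x hx]
    linarith
  · linarith [le_csSup hb hx]

theorem integral_abs_cos_nat_mul {n : ℕ} (hn : 0 < n) (j : ℕ) :
    ∫ θ in (j * (Real.pi / n))..((j + 1 : ℕ) * (Real.pi / n)), |Real.cos (n * θ)| = 2 / n := by
  have hn' : (n : ℝ) ≠ 0 := by positivity
  have h1 : (n : ℝ) * (j * (Real.pi / n)) = j * Real.pi := by field_simp
  have h2 : (n : ℝ) * ((j + 1 : ℕ) * (Real.pi / n)) = j * Real.pi + Real.pi := by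
    push_cast; field_simp
  have hper : Function.Periodic (fun x => |Real.cos x|) Real.pi := fun x => by
    simp [Real.cos_add_pi]
  have h3 : ∫ x in (-(Real.pi / 2))..(-(Real.pi / 2) + Real.pi), |Real.cos x| = 2 := by
    have : -(Real.pi / 2) + Real.pi = Real.pi / 2 := by ring
    rw [this, intervalIntegral.integral_congr (g := Real.cos)]
    · rw [integral_cos]; simp; norm_num
    · intro x hx
      rw [uIcc_of_le (by linarith [Real.pi_pos])] at hx
      exact abs_of_nonneg (Real.cos_nonneg_of_mem_Icc hx)
  rw [intervalIntegral.integral_comp_mul_left (fun x => |Real.cos x|) hn', h1, h2,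
    hper.intervalIntegral_add_eq (j * Real.pi) (-(Real.pi / 2)), h3, smul_eq_mul]
  field_simp

theorem integral_cos_nat_mul_eq_zero {n : ℕ} (hn : 0 < n) (j : ℕ) :
    ∫ θ in (j * (Real.pi / n))..((j + 1 : ℕ) * (Real.pi / n)), Real.cos (n * θ) = 0 := by
  have hn' : (n : ℝ) ≠ 0 := by positivity
  have h1 : (n : ℝ) * (j * (Real.pi / n)) = j * Real.pi := by field_simp
  have h2 : (n : ℝ) * ((j + 1 : ℕ) * (Real.pi / n)) = (j + 1 : ℕ) * Real.pi := by field_simp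
  rw [intervalIntegral.integral_comp_mul_left Real.cos hn', h1, h2, integral_cos,
    Real.sin_nat_mul_pi, Real.sin_nat_mul_pi]
  simp

theorem LocallyBoundedVariationOn.intervalIntegrable {g : ℝ → ℝ} {a b : ℝ}
    (h : LocallyBoundedVariationOn g (uIcc a b)) : IntervalIntegrable g volume a b := by
  obtain ⟨p, q, hp, hq, rfl⟩ := h.exists_monotoneOn_sub_monotoneOn
  exact hp.intervalIntegrable.sub hq.intervalIntegrable

theorem LocallyBoundedVariationOn.countable_not_continuousWithinAt {g : ℝ → ℝ} {s : Set ℝ}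
    (h : LocallyBoundedVariationOn g s) : {x ∈ s | ¬ ContinuousWithinAt g s x}.Countable := by
  obtain ⟨p, q, hp, hq, rfl⟩ := h.exists_monotoneOn_sub_monotoneOn
  refine (hp.countable_not_continuousWithinAt.union hq.countable_not_continuousWithinAt).mono ?_
  rintro x ⟨hx, hc⟩
  by_contra hcon
  simp only [mem_union, mem_ofPred_eq, not_or, not_and, not_not] at hcon
  exact hc ((hcon.1 hx).sub (hcon.2 hx))

/-- The cosine coefficients of a function of bounded variation decay like `V / n`. -/
theorem abs_integral_mul_cos_le {G : ℝ → ℝ} {V : ℝ≥0}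
    (hG : eVariationOn G (Icc 0 Real.pi) ≤ V) {n : ℕ} (hn : 0 < n) :
    |∫ θ in 0..Real.pi, G θ * Real.cos (n * θ)| ≤ V / n := by
  have hn' : (0 : ℝ) < n := by positivity
  have hBV : BoundedVariationOn G (Icc 0 Real.pi) := ne_top_of_le_ne_top ENNReal.coe_ne_top hG
  set t : ℕ → ℝ := fun j => j * (Real.pi / n) with ht
  have htm : Monotone t := fun i j hij => by
    have : (i : ℝ) ≤ j := by exact_mod_cast hij
    have := Real.pi_pos
    simp only [ht]; gcongr
  have ht0 : t 0 = 0 := by simp [ht]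
  have htn : t n = Real.pi := by simp only [ht]; field_simp
  have hsub : ∀ j < n, Icc (t j) (t (j + 1)) ⊆ Icc 0 Real.pi := fun j hj =>
    Icc_subset_Icc (ht0 ▸ htm (Nat.zero_le _)) (htn ▸ htm hj)
  have hGi : ∀ j < n, IntervalIntegrable G volume (t j) (t (j + 1)) := fun j hj =>
    LocallyBoundedVariationOn.intervalIntegrable <| by
      rw [uIcc_of_le (htm j.le_succ)]
      exact (hBV.mono (hsub j hj)).locallyBoundedVariationOn
  have hcc : Continuous fun θ : ℝ => Real.cos (n * θ) := by fun_prop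
  have hpiece : ∀ j < n, |∫ θ in t j..t (j + 1), G θ * Real.cos (n * θ)| ≤
      (eVariationOn G (Icc (t j) (t (j + 1)))).toReal / n := by
    intro j hj
    have hle := htm j.le_succ
    obtain ⟨c, hc⟩ := exists_abs_sub_le_half (S := G '' Icc (t j) (t (j + 1)))
      ((nonempty_Icc.2 hle).image _) (v := (eVariationOn G (Icc (t j) (t (j + 1)))).toReal) <| by
        rintro _ ⟨x, hx, rfl⟩ _ ⟨y, hy, rfl⟩
        exact (hBV.mono (hsub j hj)).sub_le hx hy
    have h1 : ∫ θ in t j..t (j + 1), G θ * Real.cos (n * θ) =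
        ∫ θ in t j..t (j + 1), (G θ - c) * Real.cos (n * θ) := by
      simp_rw [sub_mul]
      rw [intervalIntegral.integral_sub ((hGi j hj).mul_continuousOn hcc.continuousOn)
        ((hcc.const_mul c |>.intervalIntegrable _ _)), intervalIntegral.integral_const_mul,
        integral_cos_nat_mul_eq_zero hn j, mul_zero, sub_zero]
    rw [h1, ← Real.norm_eq_abs]
    calc _ ≤ ∫ θ in t j..t (j + 1), (eVariationOn G (Icc (t j) (t (j + 1)))).toReal / 2 *
              |Real.cos (n * θ)| := by
            refine intervalIntegral.norm_integral_le_of_norm_le hle (ae_of_all _ fun θ hθ => ?_)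
              ((hcc.abs.const_mul _).intervalIntegrable _ _)
            rw [norm_mul, Real.norm_eq_abs, Real.norm_eq_abs]
            exact mul_le_mul_of_nonneg_right (hc _ ⟨θ, Ioc_subset_Icc_self hθ, rfl⟩) (abs_nonneg _)
      _ = _ := by
            rw [intervalIntegral.integral_const_mul, integral_abs_cos_nat_mul hn j]; ring
  have hsum : ∑ j ∈ Finset.range n, ∫ θ in t j..t (j + 1), G θ * Real.cos (n * θ) =
      ∫ θ in 0..Real.pi, G θ * Real.cos (n * θ) := by
    rw [intervalIntegral.sum_integral_adjacent_intervals fun j hj =>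
      (hGi j hj).mul_continuousOn hcc.continuousOn, ht0, htn]
  have hvar : ∑ j ∈ Finset.range n, (eVariationOn G (Icc (t j) (t (j + 1)))).toReal ≤ V := by
    rw [← ENNReal.toReal_sum fun j hj => hBV.mono (hsub j (Finset.mem_range.1 hj)),
      eVariationOn.sum' G htm, ht0, htn]
    exact ENNReal.toReal_le_coe_of_le_coe hG
  rw [← hsum]
  calc _ ≤ ∑ j ∈ Finset.range n, |∫ θ in t j..t (j + 1), G θ * Real.cos (n * θ)| :=
        Finset.abs_sum_le_sum_abs _ _
    _ ≤ ∑ j ∈ Finset.range n, (eVariationOn G (Icc (t j) (t (j + 1)))).toReal / n :=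
        Finset.sum_le_sum fun j hj => hpiece j (Finset.mem_range.1 hj)
    _ ≤ _ := by rw [← Finset.sum_div]; gcongr

/-- The affine cosine parametrisation of `[a,b]` by `[0,π]`. -/
noncomputable def cosArc (a b θ : ℝ) : ℝ := (a + b) / 2 + (b - a) / 2 * Real.cos θ

/-- The (unnormalised) Chebyshev coefficient of `f` on `[a,b]`. -/
noncomputable def cosMoment (a b : ℝ) (f : ℝ → ℝ) (n : ℕ) : ℝ :=
  ∫ θ in 0..Real.pi, f (cosArc a b θ) * Real.cos (n * θ)

section CosArc
variable {a b : ℝ}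

@[fun_prop]
theorem continuous_cosArc : Continuous (cosArc a b) := by unfold cosArc; fun_prop

theorem cosArc_zero : cosArc a b 0 = b := by simp [cosArc]; ring

theorem cosArc_pi : cosArc a b Real.pi = a := by simp [cosArc]; ring

theorem cosArc_mem_Icc (hab : a ≤ b) (θ : ℝ) : cosArc a b θ ∈ Icc a b := by
  have h1 := Real.neg_one_le_cos θ
  have h2 := Real.cos_le_one θ
  constructor <;> unfold cosArc <;> nlinarith

theorem strictAntiOn_cosArc (hab : a < b) : StrictAntiOn (cosArc a b) (Icc 0 Real.pi) := by
  intro x hx y hy hxy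
  have := Real.strictAntiOn_cos hx hy hxy
  have hh : 0 < (b - a) / 2 := by linarith
  unfold cosArc
  nlinarith

theorem cosArc_mem_Ioo (hab : a < b) {θ : ℝ} (hθ : θ ∈ Ioo 0 Real.pi) :
    cosArc a b θ ∈ Ioo a b := by
  have hp := Real.pi_pos.le
  constructor
  · simpa [cosArc_pi] using
      strictAntiOn_cosArc hab (Ioo_subset_Icc_self hθ) (right_mem_Icc.2 hp) hθ.2
  · simpa [cosArc_zero] using
      strictAntiOn_cosArc hab (left_mem_Icc.2 hp) (Ioo_subset_Icc_self hθ) hθ.1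

theorem hasDerivAt_cosArc (θ : ℝ) :
    HasDerivAt (cosArc a b) ((b - a) / 2 * -Real.sin θ) θ :=
  ((Real.hasDerivAt_cos θ).const_mul _).const_add _

theorem eVariationOn_comp_cosArc_le (hab : a < b) (g : ℝ → ℝ) :
    eVariationOn (fun θ => g (cosArc a b θ)) (Icc 0 Real.pi) ≤ eVariationOn g (Icc a b) :=
  eVariationOn.comp_le_of_antitoneOn g (cosArc a b) (strictAntiOn_cosArc hab).antitoneOn
    fun θ _ => cosArc_mem_Icc hab.le θ

theorem abs_cosMoment_le_of_eVariationOn_le (hab : a < b) {g : ℝ → ℝ} {V : ℝ≥0}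
    (hg : eVariationOn g (Icc a b) ≤ V) {n : ℕ} (hn : 0 < n) : |cosMoment a b g n| ≤ V / n :=
  abs_integral_mul_cos_le ((eVariationOn_comp_cosArc_le hab g).trans hg) hn

/-- Integration by parts for Chebyshev coefficients. -/
theorem cosMoment_eq_sub (hab : a < b) {f g : ℝ → ℝ} {s : Set ℝ} (hs : s.Countable)
    (hf : ContinuousOn f (Icc a b)) (hd : ∀ x ∈ Ioo a b \ s, HasDerivAt f (g x) x)
    (hg : IntervalIntegrable (fun θ => g (cosArc a b θ)) volume 0 Real.pi) {n : ℕ} (hn : 0 < n) :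
    cosMoment a b f n =
      (b - a) / 2 / (2 * n) * (cosMoment a b g (n - 1) - cosMoment a b g (n + 1)) := by
  have hn' : (n : ℝ) ≠ 0 := by positivity
  have hF : ContinuousOn (fun θ => f (cosArc a b θ)) (Icc 0 Real.pi) :=
    hf.comp continuous_cosArc.continuousOn fun θ _ => cosArc_mem_Icc hab.le θ
  have hFi : IntervalIntegrable (fun θ => f (cosArc a b θ) * Real.cos (n * θ)) volume 0 Real.pi := by
    refine ContinuousOn.intervalIntegrable ?_
    rw [uIcc_of_le Real.pi_pos.le]
    exact hF.mul (by fun_prop)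
  have hGi : IntervalIntegrable
      (fun θ => g (cosArc a b θ) * ((b - a) / 2 * -Real.sin θ * (Real.sin (n * θ) / n)))
      volume 0 Real.pi := hg.mul_continuousOn (by fun_prop)
  set t : Set ℝ := Ioo 0 Real.pi ∩ cosArc a b ⁻¹' s with ht
  have htc : t.Countable := by
    refine MapsTo.countable_of_injOn (f := cosArc a b) (t := s) (fun θ hθ => hθ.2) ?_ hs
    exact (strictAntiOn_cosArc hab).injOn.mono fun θ hθ => Ioo_subset_Icc_self hθ.1
  have key := integral_eq_of_hasDerivAt_off_countable_of_le
    (fun θ => f (cosArc a b θ) * (Real.sin (n * θ) / n))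
    (fun θ => g (cosArc a b θ) * ((b - a) / 2 * -Real.sin θ * (Real.sin (n * θ) / n)) +
      f (cosArc a b θ) * Real.cos (n * θ)) Real.pi_pos.le htc
    (hF.mul (by fun_prop)) (fun θ hθ => by
      have h1 := (hd _ ⟨cosArc_mem_Ioo hab hθ.1, fun h => hθ.2 ⟨hθ.1, h⟩⟩).comp θ
        (hasDerivAt_cosArc θ)
      have h2 : HasDerivAt (fun θ : ℝ => Real.sin (n * θ) / n) (Real.cos (n * θ)) θ := by
        have := ((Real.hasDerivAt_sin (n * θ)).comp θ
          ((hasDerivAt_id θ).const_mul (n : ℝ))).div_const (n : ℝ)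
        refine this.congr_deriv ?_
        simp; field_simp
      refine (h1.mul h2).congr_deriv ?_
      simp only [Function.comp]; ring) (hGi.add hFi)
  rw [intervalIntegral.integral_add hGi hFi, Real.sin_nat_mul_pi] at key
  simp only [mul_zero, Real.sin_zero, zero_div, sub_zero] at key
  have hc : ∀ m : ℕ, IntervalIntegrable (fun θ => g (cosArc a b θ) * Real.cos (m * θ))
      volume 0 Real.pi := fun m => hg.mul_continuousOn (by fun_prop)
  have h3 : (cosMoment a b g (n - 1) - cosMoment a b g (n + 1)) * ((b - a) / 2 / (2 * n)) =
      -∫ θ in 0..Real.pi,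
        g (cosArc a b θ) * ((b - a) / 2 * -Real.sin θ * (Real.sin (n * θ) / n)) := by
    rw [cosMoment, cosMoment, ← intervalIntegral.integral_sub (hc _) (hc _),
      ← intervalIntegral.integral_mul_const, ← intervalIntegral.integral_neg]
    refine intervalIntegral.integral_congr fun θ _ => ?_
    have e1 : ((n - 1 : ℕ) : ℝ) * θ = n * θ - θ := by
      rw [Nat.cast_sub hn]; push_cast; ring
    have e2 : ((n + 1 : ℕ) : ℝ) * θ = n * θ + θ := by push_cast; ring
    simp only [e1, e2, Real.cos_add, Real.cos_sub]
    field_simp; ring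
  rw [mul_comm, h3]
  unfold cosMoment
  linarith

theorem hasDerivAt_of_eq_integral {f g : ℝ → ℝ} (hg : BoundedVariationOn g (Icc a b))
    (hf : ∀ x ∈ Icc a b, f x = f a + ∫ t in a..x, g t) :
    ∃ s : Set ℝ, s.Countable ∧ ∀ x ∈ Ioo a b \ s, HasDerivAt f (g x) x := by
  refine ⟨_, hg.locallyBoundedVariationOn.countable_not_continuousWithinAt, ?_⟩
  rintro x ⟨hx, hxs⟩
  have hab : a ≤ b := (hx.1.trans hx.2).le
  have hgi : IntervalIntegrable g volume a b := LocallyBoundedVariationOn.intervalIntegrable <| by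
    rw [uIcc_of_le hab]; exact hg.locallyBoundedVariationOn
  have hc : ContinuousAt g x := by
    by_contra hcon
    exact hxs ⟨Ioo_subset_Icc_self hx,
      fun h => hcon (h.continuousAt (Icc_mem_nhds hx.1 hx.2))⟩
  have h1 : HasDerivAt (fun y => ∫ t in a..y, g t) (g x) x :=
    intervalIntegral.integral_hasDerivAt_right
      (hgi.mono_set (uIcc_subset_uIcc left_mem_uIcc
        (by rw [uIcc_of_le hab]; exact Ioo_subset_Icc_self hx)))
      ⟨Ioc a b, Ioc_mem_nhds hx.1 hx.2, hgi.1.aestronglyMeasurable⟩ hc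
  refine (h1.const_add (f a)).congr_of_eventuallyEq ?_
  filter_upwards [Icc_mem_nhds hx.1 hx.2] with y hy using hf y hy

theorem abs_cosMoment_le_of_parts (hab : a < b) {f g : ℝ → ℝ} {n r : ℕ} (hn : r + 1 < n) {V : ℝ}
    (h : cosMoment a b f n =
      (b - a) / 2 / (2 * n) * (cosMoment a b g (n - 1) - cosMoment a b g (n + 1)))
    (hg : ∀ m : ℕ, r < m → |cosMoment a b g m| ≤
      V * ((b - a) / 2) ^ r / ((m : ℝ) - r) ^ (r + 1)) (hV : 0 ≤ V) :
    |cosMoment a b f n| ≤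
      V * ((b - a) / 2) ^ (r + 1) / ((n : ℝ) - (r + 1 : ℕ)) ^ (r + 1 + 1) := by
  have hh : 0 < (b - a) / 2 := by linarith
  have hn0 : (0 : ℝ) < n := by have : 0 < n := by omega
                               positivity
  have hnr : (0 : ℝ) < (n : ℝ) - (r + 1 : ℕ) := by
    have : ((r + 1 : ℕ) : ℝ) < n := by exact_mod_cast hn
    linarith
  set B := V * ((b - a) / 2) ^ r / ((n : ℝ) - (r + 1 : ℕ)) ^ (r + 1) with hB
  have hB0 : 0 ≤ B := by positivity
  have h1 : |cosMoment a b g (n - 1)| ≤ B := by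
    refine (hg (n - 1) (by omega)).trans_eq ?_
    rw [Nat.cast_sub (by omega), hB]; push_cast; ring
  have h2 : |cosMoment a b g (n + 1)| ≤ B := by
    refine (hg (n + 1) (by omega)).trans ?_
    refine div_le_div_of_nonneg_left (by positivity) (by positivity)
      (pow_le_pow_left₀ hnr.le ?_ _)
    push_cast; linarith
  rw [h, abs_mul, abs_of_pos (by positivity)]
  calc (b - a) / 2 / (2 * n) * |cosMoment a b g (n - 1) - cosMoment a b g (n + 1)|
      ≤ (b - a) / 2 / (2 * n) * (B + B) := by
        gcongr
        exact (abs_sub _ _).trans (add_le_add h1 h2)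
    _ = (b - a) / 2 * B / n := by field_simp; ring
    _ ≤ (b - a) / 2 * B / ((n : ℝ) - (r + 1 : ℕ)) := by
        gcongr
        have : (0 : ℝ) ≤ (r + 1 : ℕ) := by positivity
        linarith
    _ = _ := by rw [hB, pow_succ _ (r + 1)]; field_simp; ring

/-- Decay of the Chebyshev coefficients of a function whose `r`-th derivative has
variation at most `V`. -/
theorem HasDerivOfVariationLE.abs_cosMoment_le (hab : a < b) {V : ℝ≥0} {r : ℕ} {f : ℝ → ℝ}
    (hf : HasDerivOfVariationLE a b V r f) {n : ℕ} (hn : r < n) :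
    |cosMoment a b f n| ≤ V * ((b - a) / 2) ^ r / ((n : ℝ) - r) ^ (r + 1) := by
  rcases r with _ | m
  · simpa using abs_cosMoment_le_of_eVariationOn_le hab hf.2 hn
  induction m generalizing f n with
  | zero =>
    obtain ⟨hc, g, hgV, hg⟩ := hf
    simp only [iteratedDerivWithin_zero] at hg
    have hBV : BoundedVariationOn g (Icc a b) := ne_top_of_le_ne_top ENNReal.coe_ne_top hgV
    obtain ⟨s, hs, hd⟩ := hasDerivAt_of_eq_integral hBV hg
    refine abs_cosMoment_le_of_parts hab hn (cosMoment_eq_sub hab hs hc.continuousOn hd ?_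
      (by omega)) (fun m hm => ?_) V.2
    · refine LocallyBoundedVariationOn.intervalIntegrable ?_
      rw [uIcc_of_le Real.pi_pos.le]
      exact BoundedVariationOn.locallyBoundedVariationOn
        (ne_top_of_le_ne_top hBV (eVariationOn_comp_cosArc_le hab g))
    · simpa using abs_cosMoment_le_of_eVariationOn_le hab hgV hm
  | succ m ih =>
    obtain ⟨hc, g, hgV, hg⟩ := hf
    have hc' : ContDiffOn ℝ ((m : WithTop ℕ∞) + 1) f (Icc a b) := by exact_mod_cast hc
    obtain ⟨hdiff, -, hc1⟩ := (contDiffOn_succ_iff_derivWithin (uniqueDiffOn_Icc hab)).1 hc'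
    simp only [iteratedDerivWithin_succ'] at hg
    refine abs_cosMoment_le_of_parts hab hn (g := derivWithin f (Icc a b))
      (cosMoment_eq_sub hab countable_empty hc.continuousOn (fun x hx => ?_) ?_ (by omega))
      (fun k hk => ih ⟨hc1, g, hgV, hg⟩ hk) V.2
    · have hx' := Icc_mem_nhds hx.1.1 hx.1.2
      exact (hdiff x (Ioo_subset_Icc_self hx.1)).hasDerivWithinAt.hasDerivAt hx'
    · refine ContinuousOn.intervalIntegrable ?_
      exact hc1.continuousOn.comp continuous_cosArc.continuousOn fun θ _ => cosArc_mem_Icc hab.le θ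

end CosArc

theorem integral_neg_pi_pi_eq {E : Type*} [NormedAddCommGroup E] [NormedSpace ℝ E]
    {φ : ℝ → E} (hφ : Continuous φ) :
    ∫ θ in (-Real.pi)..Real.pi, φ θ = ∫ θ in 0..Real.pi, (φ θ + φ (-θ)) := by
  rw [← intervalIntegral.integral_add_adjacent_intervals (b := 0) (hφ.intervalIntegrable _ _)
    (hφ.intervalIntegrable _ _), intervalIntegral.integral_add (hφ.intervalIntegrable _ _)
    ((show Continuous fun θ => φ (-θ) from hφ.comp continuous_neg).intervalIntegrable _ _),
    intervalIntegral.integral_comp_neg, neg_zero, add_comm]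

/-- Parseval's identity for the cosine series of an even function. -/
theorem hasSum_sq_integral_mul_cos {G : ℝ → ℝ} (hG : Continuous G) (heven : ∀ θ, G (-θ) = G θ) :
    HasSum (fun i : ℤ => (Real.pi⁻¹ * ∫ θ in 0..Real.pi, G θ * Real.cos (i * θ)) ^ 2)
      (Real.pi⁻¹ * ∫ θ in 0..Real.pi, G θ ^ 2) := by
  have hpi := Real.pi_pos
  have hab : -Real.pi < Real.pi := by linarith
  have hGc : Continuous fun θ => (G θ : ℂ) := Complex.continuous_ofReal.comp hG
  have hmem : MemLp (fun θ => (G θ : ℂ)) 2 (volume.restrict (Ioc (-Real.pi) Real.pi)) :=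
    (memLp_two_iff_integrable_sq_norm hGc.aestronglyMeasurable).2
      (by fun_prop : Continuous fun θ => ‖(G θ : ℂ)‖ ^ 2).integrableOn_Ioc
  have h := hasSum_sq_fourierCoeffOn hab hmem
  have hcoef : ∀ i : ℤ, fourierCoeffOn hab (fun θ => (G θ : ℂ)) i =
      ((Real.pi⁻¹ * ∫ θ in 0..Real.pi, G θ * Real.cos (i * θ) : ℝ) : ℂ) := by
    intro i
    have e : ∀ x : ℝ, fourier (-i) (x : AddCircle (Real.pi - -Real.pi)) • (G x : ℂ) =
        Complex.exp (-(i * x * Complex.I)) * G x := by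
      intro x
      rw [fourier_coe_apply, smul_eq_mul]
      congr 2
      push_cast
      have : (Real.pi : ℂ) ≠ 0 := by exact_mod_cast hpi.ne'
      field_simp
      ring
    rw [fourierCoeffOn_eq_integral]
    simp_rw [e]
    rw [integral_neg_pi_pi_eq (by fun_prop)]
    have e2 : ∀ x : ℝ, Complex.exp (-(i * x * Complex.I)) * G x +
        Complex.exp (-(i * (-x : ℝ) * Complex.I)) * G (-x) =
        ((2 * (G x * Real.cos (i * x)) : ℝ) : ℂ) := by
      intro x
      rw [heven]
      push_cast
      rw [Complex.cos]
      ring_nf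
    simp_rw [e2]
    rw [intervalIntegral.integral_ofReal, intervalIntegral.integral_const_mul, Complex.real_smul,
      ← Complex.ofReal_mul]
    congr 1
    field_simp; ring
  simp_rw [hcoef, Complex.norm_real, Real.norm_eq_abs, sq_abs] at h
  convert h using 1
  rw [integral_neg_pi_pi_eq (by fun_prop)]
  simp_rw [heven, ← two_mul]
  rw [intervalIntegral.integral_const_mul, smul_eq_mul]
  field_simp; ring

theorem integral_cos_int_mul (m : ℤ) :
    ∫ θ in 0..Real.pi, Real.cos (m * θ) = if m = 0 then Real.pi else 0 := by
  split_ifs with h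
  · simp [h]
  · rw [intervalIntegral.integral_comp_mul_left Real.cos (by exact_mod_cast h), integral_cos,
      Real.sin_int_mul_pi]
    simp

theorem integral_cos_mul_cos (j n : ℕ) :
    ∫ θ in 0..Real.pi, Real.cos (j * θ) * Real.cos (n * θ) =
      if j = n then (if j = 0 then Real.pi else Real.pi / 2) else 0 := by
  have h : ∀ θ : ℝ, Real.cos (j * θ) * Real.cos (n * θ) =
      (Real.cos (((j - n : ℤ) : ℝ) * θ) + Real.cos (((j + n : ℤ) : ℝ) * θ)) / 2 := by
    intro θ
    push_cast
    rw [sub_mul, add_mul, Real.cos_sub, Real.cos_add]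
    ring
  simp_rw [h]
  rw [intervalIntegral.integral_div, intervalIntegral.integral_add
    ((by fun_prop : Continuous _).intervalIntegrable _ _)
    ((by fun_prop : Continuous _).intervalIntegrable _ _),
    integral_cos_int_mul, integral_cos_int_mul]
  by_cases hjn : j = n
  · subst hjn
    rcases Nat.eq_zero_or_pos j with rfl | hj
    · simp
    · have : (j : ℤ) + j ≠ 0 := by omega
      simp [this, hj.ne']
  · have h1 : (j : ℤ) - n ≠ 0 := by omega
    have h2 : (j : ℤ) + n ≠ 0 := by omega
    simp [h1, h2, hjn]

theorem one_div_pow_succ_le_sub {s : ℝ} (hs : 1 < s) {p : ℕ} (hp : 0 < p) :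
    1 / s ^ (p + 1) ≤ 1 / p * (1 / (s - 1) ^ p - 1 / s ^ p) := by
  have hs0 : 0 < s := by linarith
  have hs1 : 0 < s - 1 := by linarith
  have hp' : (0 : ℝ) < p := by positivity
  have h1 : 1 + p * (1 / (s - 1)) ≤ (1 + 1 / (s - 1)) ^ p :=
    one_add_mul_le_pow (by have : 0 < 1 / (s - 1) := by positivity
                           linarith) p
  have h2 : (p : ℝ) / s ≤ p * (1 / (s - 1)) := by
    rw [mul_one_div]; gcongr; linarith
  have h3 : 1 + 1 / (s - 1) = s / (s - 1) := by field_simp; ring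
  rw [h3, div_pow] at h1
  have h4 : (1 + p / s) / s ^ p ≤ (s ^ p / (s - 1) ^ p) / s ^ p := by
    gcongr; linarith
  have h5 : (s ^ p / (s - 1) ^ p) / s ^ p = 1 / (s - 1) ^ p := by field_simp
  have h6 : (1 + p / s) / s ^ p = 1 / s ^ p + p * (1 / s ^ (p + 1)) := by
    rw [pow_succ]; field_simp
  rw [h5, h6] at h4
  rw [one_div_mul_eq_div, le_div_iff₀ hp']
  linarith

/-- The square of the `L²(0,π)` norm of an even function, the first `k` cosine coefficients of which
vanish and the others of which decay. -/
theorem integral_sq_le_of_cosine_decay {G : ℝ → ℝ} (hG : Continuous G)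
    (heven : ∀ θ, G (-θ) = G θ) {k r : ℕ} (hk : r + 1 < k) {C : ℝ}
    (h0 : ∀ n < k, ∫ θ in 0..Real.pi, G θ * Real.cos (n * θ) = 0)
    (h1 : ∀ n : ℕ, k ≤ n → |∫ θ in 0..Real.pi, G θ * Real.cos (n * θ)| ≤
      C / ((n : ℝ) - r) ^ (r + 1)) :
    ∫ θ in 0..Real.pi, G θ ^ 2 ≤
      C ^ 2 / (Real.pi * (r + 1 / 2)) / ((k : ℝ) - r - 1) ^ (2 * r + 1) := by
  have hpi := Real.pi_pos
  set c : ℕ → ℝ := fun n => ∫ θ in 0..Real.pi, G θ * Real.cos (n * θ) with hc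
  have hsum := (hasSum_sq_integral_mul_cos hG heven).nat_add_neg
  have hz : (Real.pi⁻¹ * ∫ θ in 0..Real.pi, G θ * Real.cos ((0 : ℤ) * θ)) = 0 := by
    have := h0 0 (by omega)
    rw [Nat.cast_zero] at this
    rw [Int.cast_zero, this, mul_zero]
  rw [hz] at hsum
  have hterm : ∀ n : ℕ, (Real.pi⁻¹ * ∫ θ in 0..Real.pi, G θ * Real.cos ((n : ℤ) * θ)) ^ 2 +
      (Real.pi⁻¹ * ∫ θ in 0..Real.pi, G θ * Real.cos ((-n : ℤ) * θ)) ^ 2 =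
      2 * Real.pi⁻¹ ^ 2 * c n ^ 2 := by
    intro n
    simp only [hc, Int.cast_neg, neg_mul, Real.cos_neg, Int.cast_natCast]
    ring
  simp_rw [hterm] at hsum
  have hpart : ∀ N, k ≤ N → ∑ n ∈ Finset.range N, c n ^ 2 ≤
      C ^ 2 * (1 / (2 * r + 1 : ℕ) * (1 / ((k : ℝ) - r - 1) ^ (2 * r + 1) -
        1 / ((N : ℝ) - r - 1) ^ (2 * r + 1))) := by
    intro N hN
    induction N, hN using Nat.le_induction with
    | base =>
      rw [Finset.sum_eq_zero fun n hn => by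
        rw [show c n = 0 from h0 n (Finset.mem_range.1 hn)]; ring]
      simp
    | succ N hN ih =>
      have hN' : (r : ℝ) + 1 < N := by exact_mod_cast lt_of_lt_of_le hk hN
      have hs := one_div_pow_succ_le_sub (s := (N : ℝ) - r) (by linarith) (p := 2 * r + 1) (by omega)
      have hcN : c N ^ 2 ≤ C ^ 2 * (1 / ((N : ℝ) - r) ^ (2 * r + 1 + 1)) := by
        have := h1 N hN
        rw [← sq_abs]
        calc |c N| ^ 2 ≤ (C / ((N : ℝ) - r) ^ (r + 1)) ^ 2 := by gcongr
          _ = _ := by rw [div_pow, ← pow_mul]; ring_nf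
      rw [Finset.sum_range_succ]
      have := mul_le_mul_of_nonneg_left hs (sq_nonneg C)
      push_cast at *
      rw [show (N : ℝ) + 1 - r - 1 = N - r by ring]
      linarith
  have hk' : (r : ℝ) + 1 < k := by exact_mod_cast hk
  have hle : Real.pi⁻¹ * (∫ θ in 0..Real.pi, G θ ^ 2) + 0 ^ 2 ≤
      2 * Real.pi⁻¹ ^ 2 * (C ^ 2 * (1 / (2 * r + 1 : ℕ) * (1 / ((k : ℝ) - r - 1) ^ (2 * r + 1)))) := by
    refine le_of_tendsto hsum.tendsto_sum_nat ?_
    filter_upwards [eventually_ge_atTop k] with N hN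
    rw [← Finset.mul_sum]
    refine mul_le_mul_of_nonneg_left ((hpart N hN).trans ?_) (by positivity)
    have hN' : (r : ℝ) + 1 < N := by exact_mod_cast lt_of_lt_of_le hk hN
    have : 0 < (N : ℝ) - r - 1 := by linarith
    gcongr
    have : 0 ≤ 1 / ((N : ℝ) - r - 1) ^ (2 * r + 1) := by positivity
    linarith
  have hk0 : 0 < (k : ℝ) - r - 1 := by linarith
  have := mul_le_mul_of_nonneg_left hle hpi.le
  have e1 : Real.pi * (Real.pi⁻¹ * (∫ θ in 0..Real.pi, G θ ^ 2) + 0 ^ 2) =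
    ∫ θ in 0..Real.pi, G θ ^ 2 := by field_simp; ring
  rw [e1] at this
  refine this.trans_eq ?_
  push_cast
  field_simp

/-- The Chebyshev polynomial `T_j`, transported to `[a,b]`. -/
noncomputable def chebFun (a b : ℝ) (j : ℕ) (x : ℝ) : ℝ :=
  Real.cos (j * Real.arccos ((x - (a + b) / 2) / ((b - a) / 2)))

theorem continuous_chebFun (a b : ℝ) (j : ℕ) : Continuous (chebFun a b j) := by
  unfold chebFun
  exact Real.continuous_cos.comp (continuous_const.mul (Real.continuous_arccos.comp (by fun_prop)))

theorem chebFun_cosArc {a b : ℝ} (hab : a < b) (j : ℕ) {θ : ℝ} (hθ : θ ∈ Icc 0 Real.pi) :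
    chebFun a b j (cosArc a b θ) = Real.cos (j * θ) := by
  have : (b - a) / 2 ≠ 0 := by linarith
  rw [chebFun, cosArc, add_sub_cancel_left, mul_div_cancel_left₀ _ this, Real.arccos_cos hθ.1 hθ.2]

theorem integral_sq_le_integral_sq_cosArc {a b : ℝ} (hab : a < b) {φ : ℝ → ℝ}
    (hφ : ContinuousOn φ (Icc a b)) :
    ∫ x in a..b, φ x ^ 2 ≤ (b - a) / 2 * ∫ θ in 0..Real.pi, φ (cosArc a b θ) ^ 2 := by
  have hpi := Real.pi_pos.le
  have himg : cosArc a b '' uIcc 0 Real.pi ⊆ Icc a b := by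
    rintro _ ⟨θ, -, rfl⟩; exact cosArc_mem_Icc hab.le θ
  have h := intervalIntegral.integral_comp_mul_deriv'' (a := 0) (b := Real.pi) (f := cosArc a b)
    (f' := fun θ => (b - a) / 2 * -Real.sin θ) (g := fun x => φ x ^ 2)
    continuous_cosArc.continuousOn (fun θ _ => (hasDerivAt_cosArc θ).hasDerivWithinAt)
    (by fun_prop) ((hφ.pow 2).mono himg)
  rw [cosArc_zero, cosArc_pi, intervalIntegral.integral_symm a b] at h
  have hc : Continuous fun θ => φ (cosArc a b θ) :=
    hφ.comp_continuous continuous_cosArc fun θ => cosArc_mem_Icc hab.le θ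
  rw [← neg_neg (∫ x in a..b, φ x ^ 2), ← h, ← intervalIntegral.integral_neg,
    ← intervalIntegral.integral_const_mul]
  refine intervalIntegral.integral_mono_on hpi
    (((hc.pow 2).mul (by fun_prop)).neg.intervalIntegrable _ _)
    (((hc.pow 2).const_mul _).intervalIntegrable _ _) fun θ hθ => ?_
  · have : 0 < (b - a) / 2 := by linarith
    have h1 : 0 ≤ (b - a) / 2 * φ (cosArc a b θ) ^ 2 := by positivity
    simp only [Function.comp]
    nlinarith [Real.sin_le_one θ]

/-- `L²` error of the truncated Chebyshev expansion. -/
theorem HasDerivOfVariationLE.exists_integral_sq_sub_le {a b : ℝ} (hab : a < b) {V : ℝ≥0} {r : ℕ}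
    {f : ℝ → ℝ} (hc : ContinuousOn f (Icc a b)) (hf : HasDerivOfVariationLE a b V r f)
    {k : ℕ} (hk : r + 1 < k) :
    ∃ α : Fin k → ℝ, ∫ x in a..b, (f x - ∑ j, α j * chebFun a b j x) ^ 2 ≤
      (b - a) / 2 * ((V * ((b - a) / 2) ^ r) ^ 2 / (Real.pi * (r + 1 / 2)) /
        ((k : ℝ) - r - 1) ^ (2 * r + 1)) := by
  have hpi := Real.pi_pos
  set α : Fin k → ℝ := fun j =>
    cosMoment a b f j * (if (j : ℕ) = 0 then Real.pi else Real.pi / 2)⁻¹ with hα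
  refine ⟨α, ?_⟩
  have hp : Continuous fun x => ∑ j, α j * chebFun a b j x :=
    continuous_finsetSum _ fun j _ => (continuous_chebFun a b j).const_mul _
  refine (integral_sq_le_integral_sq_cosArc hab (hc.sub hp.continuousOn)).trans ?_
  have hh : 0 < (b - a) / 2 := by linarith
  refine mul_le_mul_of_nonneg_left ?_ hh.le
  set G : ℝ → ℝ := fun θ => f (cosArc a b θ) - ∑ j, α j * Real.cos ((j : ℕ) * θ) with hG
  have hfc : Continuous fun θ => f (cosArc a b θ) :=
    hc.comp_continuous continuous_cosArc fun θ => cosArc_mem_Icc hab.le θ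
  have hGc : Continuous G := hfc.sub (by fun_prop)
  have hGe : ∀ θ, G (-θ) = G θ := fun θ => by simp [hG, cosArc]
  have hcoef : ∀ n : ℕ, ∫ θ in 0..Real.pi, G θ * Real.cos (n * θ) =
      cosMoment a b f n - ∑ j : Fin k, α j *
        (if (j : ℕ) = n then (if (j : ℕ) = 0 then Real.pi else Real.pi / 2) else 0) := by
    intro n
    simp only [hG, sub_mul, Finset.sum_mul]
    have hfn : Continuous fun θ => f (cosArc a b θ) * Real.cos (n * θ) := hfc.mul (by fun_prop)
    have hpn : Continuous fun θ => ∑ j : Fin k, α j * Real.cos ((j : ℕ) * θ) * Real.cos (n * θ) := by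
      fun_prop
    rw [intervalIntegral.integral_sub (hfn.intervalIntegrable _ _) (hpn.intervalIntegrable _ _),
      intervalIntegral.integral_finsetSum fun j _ =>
        (by fun_prop : Continuous fun θ => α j * Real.cos ((j : ℕ) * θ) *
          Real.cos (n * θ)).intervalIntegrable _ _]
    simp_rw [mul_assoc, intervalIntegral.integral_const_mul, integral_cos_mul_cos]
    rfl
  have hcongr : ∫ θ in 0..Real.pi, (f (cosArc a b θ) -
      ∑ j, α j * chebFun a b j (cosArc a b θ)) ^ 2 = ∫ θ in 0..Real.pi, G θ ^ 2 := by
    refine intervalIntegral.integral_congr fun θ hθ => ?_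
    rw [uIcc_of_le hpi.le] at hθ
    simp only [hG, chebFun_cosArc hab _ hθ]
  simp only [Pi.sub_apply]
  rw [hcongr]
  refine integral_sq_le_of_cosine_decay hGc hGe hk (fun n hn => ?_) (fun n hn => ?_)
  · rw [hcoef, Finset.sum_eq_single ⟨n, hn⟩]
    · have : (if n = 0 then Real.pi else Real.pi / 2) ≠ 0 := by split_ifs <;> positivity
      simp only [hα, if_true]
      rw [mul_assoc, inv_mul_cancel₀ this, mul_one, sub_self]
    · intro j _ hj
      rw [if_neg fun h => hj (Fin.ext h), mul_zero]
    · simp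
  · rw [hcoef, Finset.sum_eq_zero fun j _ => by rw [if_neg (by omega), mul_zero], sub_zero]
    exact hf.abs_cosMoment_le hab (by omega)

theorem ContinuousOn.memLp_two_Icc {a b : ℝ} {f : ℝ → ℝ} (hf : ContinuousOn f (Icc a b)) :
    MemLp f 2 (volume.restrict (Icc a b)) :=
  (memLp_two_iff_integrable_sq (hf.aestronglyMeasurable measurableSet_Icc)).2
    (hf.pow 2).integrableOn_Icc

theorem inner_toLp_eq_integral {α : Type*} [MeasurableSpace α] {μ : Measure α} {f : α → ℝ}
    (hf : MemLp f 2 μ) (w : Lp ℝ 2 μ) : inner ℝ (hf.toLp f) w = ∫ x, f x * w x ∂μ := by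
  rw [L2.inner_def]
  refine integral_congr_ae ?_
  filter_upwards [hf.coeFn_toLp] with x hx
  simp [hx, mul_comm]

theorem norm_sq_toLp_eq_integral {α : Type*} [MeasurableSpace α] {μ : Measure α} {f : α → ℝ}
    (hf : MemLp f 2 μ) : ‖hf.toLp f‖ ^ 2 = ∫ x, f x ^ 2 ∂μ := by
  rw [← real_inner_self_eq_norm_sq, inner_toLp_eq_integral]
  refine integral_congr_ae ?_
  filter_upwards [hf.coeFn_toLp] with x hx
  rw [hx, sq]

theorem norm_sq_eq_integral {α : Type*} [MeasurableSpace α] {μ : Measure α} (z : Lp ℝ 2 μ) :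
    ‖z‖ ^ 2 = ∫ x, z x ^ 2 ∂μ := by
  rw [← norm_sq_toLp_eq_integral (Lp.memLp z), Lp.toLp_coeFn]

/-- In the span of `N ≥ 2k` orthonormal vectors there are at least `k` orthonormal vectors
orthogonal to `k` given ones. -/
theorem exists_orthonormal_coeff_orthogonal {E : Type*} [NormedAddCommGroup E]
    [InnerProductSpace ℝ E] {N k : ℕ} (hN : 2 * k ≤ N) (u : Fin N → E) (P : Fin k → E) :
    ∃ B : Fin k → EuclideanSpace ℝ (Fin N), Orthonormal ℝ B ∧
      ∀ l j, inner ℝ (P j) (∑ i, B l i • u i) = 0 := by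
  let U : EuclideanSpace ℝ (Fin N) →ₗ[ℝ] E :=
    Fintype.linearCombination ℝ u ∘ₗ (WithLp.linearEquiv 2 ℝ (Fin N → ℝ)).toLinearMap
  let T : EuclideanSpace ℝ (Fin N) →ₗ[ℝ] (Fin k → ℝ) :=
    LinearMap.pi fun j => (innerₛₗ ℝ (P j)) ∘ₗ U
  have hdim : k ≤ Module.finrank ℝ (LinearMap.ker T) := by
    have h1 := T.finrank_range_add_finrank_ker
    have h2 : Module.finrank ℝ (LinearMap.range T) ≤ k := by
      simpa using Submodule.finrank_le (LinearMap.range T)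
    rw [finrank_euclideanSpace, Fintype.card_fin] at h1
    omega
  let b := stdOrthonormalBasis ℝ (LinearMap.ker T)
  refine ⟨fun l => (b (Fin.castLE hdim l) : EuclideanSpace ℝ (Fin N)), ?_, fun l j => ?_⟩
  · exact (b.orthonormal.comp_linearIsometry (LinearMap.ker T).subtypeₗᵢ).comp _
      (Fin.castLE_injective hdim)
  · have : T (b (Fin.castLE hdim l)) = 0 := (b (Fin.castLE hdim l)).2
    simpa [T, U, Fintype.linearCombination_apply] using congrFun this j

theorem Orthonormal.sum_smul_orthonormal {E : Type*} [NormedAddCommGroup E]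
    [InnerProductSpace ℝ E] {N k : ℕ} {u : Fin N → E} (hu : Orthonormal ℝ u)
    {B : Fin k → EuclideanSpace ℝ (Fin N)} (hB : Orthonormal ℝ B) :
    Orthonormal ℝ fun l => ∑ i, B l i • u i := by
  rw [orthonormal_iff_ite] at hB ⊢
  intro l m
  rw [← hB l m, hu.inner_sum, PiLp.inner_apply]
  simp [mul_comm]

/-- If for every `y` the function `K(·,y)` is `L²`-close to the span of `k` fixed functions, then
the `2k`-th singular value of `K` is small. -/
theorem IsSingularSystem.mul_sq_le {a b c d : ℝ} (hcd : c ≤ d) {K : ℝ → ℝ → ℝ}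
    (hK : ContinuousOn (Function.uncurry K) (Icc a b ×ˢ Icc c d)) {N k : ℕ} (hN : 2 * k ≤ N)
    {σ : Fin N → ℝ} {u : Fin N → L2Icc a b} {v : Fin N → L2Icc c d}
    (h : IsSingularSystem a b c d K σ u v) {s : ℝ} (hs0 : 0 ≤ s) (hs : ∀ i, s ≤ σ i)
    {p : Fin k → ℝ → ℝ} (hp : ∀ j, Continuous (p j)) {ε : ℝ}
    (hε : ∀ y ∈ Icc c d, ∃ α : Fin k → ℝ,
      ∫ x in Icc a b, (K x y - ∑ j, α j * p j x) ^ 2 ≤ ε) :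
    k * s ^ 2 ≤ (d - c) * ε := by
  have hpm : ∀ j, MemLp (p j) 2 (volume.restrict (Icc a b)) := fun j =>
    (hp j).continuousOn.memLp_two_Icc
  obtain ⟨B, hB, hBP⟩ := exists_orthonormal_coeff_orthogonal hN u fun j => (hpm j).toLp (p j)
  set w : Fin k → L2Icc a b := fun l => ∑ i, B l i • u i with hw
  have hwo : Orthonormal ℝ w := h.orthonormal_right.sum_smul_orthonormal hB
  set z : Fin k → L2Icc c d := fun l => ∑ i, (B l i * σ i) • v i with hz
  have hKy : ∀ y ∈ Icc c d, ContinuousOn (fun x => K x y) (Icc a b) := fun y hy =>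
    hK.comp (f := fun x => (x, y)) (by fun_prop) fun x hx => ⟨hx, hy⟩
  have hznorm : ∀ l, s ^ 2 ≤ ‖z l‖ ^ 2 := by
    intro l
    have h1 : ‖z l‖ ^ 2 = ∑ i, (B l i * σ i) ^ 2 := by
      rw [← real_inner_self_eq_norm_sq, hz, h.orthonormal_left.inner_sum]
      simp [sq]
    have h2 : ∑ i, B l i ^ 2 = 1 := by
      have := EuclideanSpace.norm_sq_eq (B l)
      rw [hB.1 l] at this
      simpa using this.symm
    calc s ^ 2 = ∑ i, B l i ^ 2 * s ^ 2 := by rw [← Finset.sum_mul, h2, one_mul]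
      _ ≤ ∑ i, (B l i * σ i) ^ 2 := Finset.sum_le_sum fun i _ => by
          rw [mul_pow]; gcongr; exact hs i
      _ = _ := h1.symm
  have hzae : ∀ᵐ y ∂(volume.restrict (Icc c d)), ∑ l, z l y ^ 2 ≤ ε := by
    have hzc : ∀ᵐ y ∂(volume.restrict (Icc c d)), ∀ l, z l y = ∑ i, B l i * σ i * v i y := by
      refine ae_all_iff.2 fun l => ?_
      filter_upwards [Lp.coeFn_finsetSum Finset.univ fun i => (B l i * σ i) • v i,
        ae_all_iff.2 fun i => Lp.coeFn_smul (B l i * σ i) (v i)] with y hy1 hy2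
      rw [hz, hy1, Finset.sum_apply]
      exact Finset.sum_congr rfl fun i _ => by rw [hy2 i]; rfl
    filter_upwards [hzc, ae_all_iff.2 h.left_eq, ae_restrict_mem measurableSet_Icc]
      with y hy1 hy2 hy
    obtain ⟨α, hα⟩ := hε y hy
    have hq : Continuous fun x => ∑ j, α j * p j x := by fun_prop
    have hm := ((hKy y hy).sub hq.continuousOn).memLp_two_Icc
    have hκ := (hKy y hy).memLp_two_Icc
    have hz' : ∀ l, z l y = inner ℝ (w l) (hm.toLp _) := by
      intro l
      have e1 : hm.toLp _ = hκ.toLp _ - ∑ j, α j • (hpm j).toLp (p j) := by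
        refine Lp.ext ?_
        filter_upwards [hm.coeFn_toLp, hκ.coeFn_toLp,
          Lp.coeFn_sub (hκ.toLp _) (∑ j, α j • (hpm j).toLp (p j)),
          Lp.coeFn_finsetSum Finset.univ fun j => α j • (hpm j).toLp (p j),
          ae_all_iff.2 fun j => Lp.coeFn_smul (α j) ((hpm j).toLp (p j)),
          ae_all_iff.2 fun j => (hpm j).coeFn_toLp] with x h1 h2 h3 h4 h5 h6
        rw [h1, h3, Pi.sub_apply, Pi.sub_apply, h2, h4, Finset.sum_apply]
        congr 1
        exact Finset.sum_congr rfl fun j _ => by rw [h5 j, Pi.smul_apply, h6 j, smul_eq_mul]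
      have e2 : inner ℝ (∑ j, α j • (hpm j).toLp (p j)) (w l) = 0 := by
        rw [sum_inner]
        exact Finset.sum_eq_zero fun j _ => by rw [inner_smul_left, hBP l j, mul_zero]
      rw [real_inner_comm, e1, inner_sub_left, e2, sub_zero, hw, inner_sum, hy1 l]
      refine Finset.sum_congr rfl fun i _ => ?_
      rw [inner_smul_right, inner_toLp_eq_integral, ← hy2 i, mul_assoc]
    calc ∑ l, z l y ^ 2 = ∑ l, ‖inner ℝ (w l) (hm.toLp _)‖ ^ 2 :=
          Finset.sum_congr rfl fun l _ => by rw [hz' l, Real.norm_eq_abs, sq_abs]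
      _ ≤ ‖hm.toLp _‖ ^ 2 := hwo.sum_inner_products_le _
      _ ≤ ε := by rw [norm_sq_toLp_eq_integral]; exact hα
  have hint : ∀ l, Integrable (fun y => z l y ^ 2) (volume.restrict (Icc c d)) := fun l =>
    (Lp.memLp (z l)).integrable_sq
  calc (k : ℝ) * s ^ 2 = ∑ _l : Fin k, s ^ 2 := by simp
    _ ≤ ∑ l, ‖z l‖ ^ 2 := Finset.sum_le_sum fun l _ => hznorm l
    _ = ∫ y in Icc c d, ∑ l, z l y ^ 2 := by
        rw [integral_finsetSum _ fun l _ => hint l]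
        exact Finset.sum_congr rfl fun l _ => norm_sq_eq_integral _
    _ ≤ ∫ _ in Icc c d, ε :=
        integral_mono_ae (integrable_finsetSum _ fun l _ => hint l) (integrable_const _) hzae
    _ = _ := by simp [hcd]

theorem decayBound_nonneg {r k : ℕ} (hk : r + 1 < k) (V : ℝ≥0) : 0 ≤ decayBound r V k := by
  have : 0 ≤ (k : ℝ) - r - 1 := by
    have : (r : ℝ) + 1 < k := by exact_mod_cast hk
    linarith
  unfold decayBound
  have := Real.pi_pos
  positivity

theorem decayBound_sq {r k : ℕ} (hk : r + 1 < k) (V : ℝ≥0) :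
    decayBound r V k ^ 2 =
      4 * V ^ 2 / (Real.pi * (r + 1 / 2)) / (k * ((k : ℝ) - r - 1) ^ (2 * r + 1)) := by
  have hq : 0 ≤ (k : ℝ) - r - 1 := by
    have : (r : ℝ) + 1 < k := by exact_mod_cast hk
    linarith
  have hx : 0 ≤ Real.pi * ((r : ℝ) + 1 / 2) := by have := Real.pi_pos; positivity
  have h1 : ((Real.pi * ((r : ℝ) + 1 / 2)) ^ (-(1 / 2) : ℝ)) ^ 2 =
      (Real.pi * ((r : ℝ) + 1 / 2))⁻¹ := by
    rw [← Real.rpow_natCast, ← Real.rpow_mul hx, ← Real.rpow_neg_one]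
    norm_num
  have h2 : (((k : ℝ) - r - 1) ^ ((r : ℝ) + 1 / 2)) ^ 2 = ((k : ℝ) - r - 1) ^ (2 * r + 1) := by
    rw [← Real.rpow_natCast, ← Real.rpow_mul hq, ← Real.rpow_natCast]
    congr 1; push_cast; ring
  rw [decayBound, div_pow, mul_pow, mul_pow, mul_pow, h1, h2, Real.sq_sqrt (Nat.cast_nonneg k)]
  ring

theorem decayBound_isBigO (r : ℕ) (V : ℝ≥0) :
    decayBound r V =O[atTop] fun k : ℕ => (k : ℝ) ^ (-((r : ℝ) + 1)) := by
  refine Asymptotics.IsBigO.of_bound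
    (2 * (V : ℝ) * (Real.pi * ((r : ℝ) + 1 / 2)) ^ (-(1 / 2) : ℝ) * 2 ^ ((r : ℝ) + 1 / 2)) ?_
  filter_upwards [eventually_ge_atTop (2 * (r + 2))] with k hk
  have hk' : (2 * (r + 2) : ℝ) ≤ k := by exact_mod_cast hk
  have hr0 : (0 : ℝ) ≤ r := by positivity
  have hk0 : (0 : ℝ) < k := by linarith
  have hpi := Real.pi_pos
  have hq : (k : ℝ) / 2 ≤ k - r - 1 := by linarith
  rw [Real.norm_of_nonneg (decayBound_nonneg (by omega) V), Real.norm_of_nonneg (by positivity),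
    decayBound]
  calc _ ≤ 2 * (V : ℝ) * (Real.pi * ((r : ℝ) + 1 / 2)) ^ (-(1 / 2) : ℝ) /
        (√(k : ℝ) * ((k : ℝ) / 2) ^ ((r : ℝ) + 1 / 2)) := by gcongr
    _ = _ := by
      have h1 : (k : ℝ) ^ (-((r : ℝ) + 1)) = (√(k : ℝ) * (k : ℝ) ^ ((r : ℝ) + 1 / 2))⁻¹ := by
        rw [Real.sqrt_eq_rpow, ← Real.rpow_add hk0, Real.rpow_neg hk0.le]
        congr 2; ring
      rw [h1, Real.div_rpow hk0.le zero_le_two]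
      field_simp

theorem IsSingularSystem.symm {a b c d : ℝ} {K : ℝ → ℝ → ℝ} {ι : Type*} {σ : ι → ℝ}
    {u : ι → L2Icc a b} {v : ι → L2Icc c d} (h : IsSingularSystem a b c d K σ u v) :
    IsSingularSystem c d a b (fun y x => K x y) σ v u :=
  ⟨h.pos, h.orthonormal_left, h.orthonormal_right, h.left_eq, h.right_eq⟩

theorem singularValue_swap (a b c d : ℝ) (K : ℝ → ℝ → ℝ) :
    singularValue a b c d K = singularValue c d a b fun y x => K x y := by
  ext n
  unfold singularValue
  congr 2
  ext s
  exact ⟨fun ⟨σ, u, v, h, hs⟩ => ⟨σ, v, u, h.symm, hs⟩,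
    fun ⟨σ, u, v, h, hs⟩ => ⟨σ, v, u, h.symm, hs⟩⟩

section

variable {a b c d : ℝ} {K : ℝ → ℝ → ℝ} {V : ℝ≥0} {r : ℕ}

theorem singularValue_le (hab : a < b) (hcd : c < d)
    (hK : ContinuousOn (Function.uncurry K) (Icc a b ×ˢ Icc c d))
    (hf : ∀ y ∈ Icc c d, HasDerivOfVariationLE a b V r fun x => K x y)
    {k n : ℕ} (hk : r + 1 < k) (hn : 2 * k ≤ n) :
    singularValue a b c d K n ≤
      √((b - a) * (d - c)) / 2 * ((b - a) / 2) ^ r * decayBound r V k := by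
  have hh : 0 < b - a := by linarith
  have hh' : 0 < d - c := by linarith
  have hR : 0 ≤ √((b - a) * (d - c)) / 2 * ((b - a) / 2) ^ r * decayBound r V k :=
    mul_nonneg (by positivity) (decayBound_nonneg hk V)
  refine csSup_le (insert_nonempty _ _) ?_
  rintro s (rfl | ⟨σ, u, v, h, hs⟩)
  · exact hR
  rcases le_total s 0 with hs0 | hs0
  · exact hs0.trans hR
  have hk0 : (0 : ℝ) < k := by have : 0 < k := by omega
                               positivity
  have hq : 0 < (k : ℝ) - r - 1 := by
    have : (r : ℝ) + 1 < k := by exact_mod_cast hk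
    linarith
  have hpi := Real.pi_pos
  have key := h.mul_sq_le hcd.le hK hn hs0 hs (fun j : Fin k => continuous_chebFun a b j)
    (fun y hy => by
      obtain ⟨α, hα⟩ := (hf y hy).exists_integral_sq_sub_le hab
        (hK.comp (f := fun x => (x, y)) (by fun_prop) fun x hx => ⟨hx, hy⟩) hk
      refine ⟨α, le_trans (le_of_eq ?_) hα⟩
      rw [intervalIntegral.integral_of_le hab.le, integral_Icc_eq_integral_Ioc]
      rfl)
  refine (pow_le_pow_iff_left₀ hs0 hR two_ne_zero).1 ?_
  refine le_of_mul_le_mul_left (key.trans ?_) hk0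
  rw [mul_pow (_ * _) (decayBound r V k), mul_pow (√_ / 2), div_pow (√_),
    Real.sq_sqrt (by positivity), decayBound_sq hk]
  set Q := (V * ((b - a) / 2) ^ r) ^ 2 / (Real.pi * (r + 1 / 2)) / ((k : ℝ) - r - 1) ^ (2 * r + 1)
    with hQ
  have hQ0 : 0 ≤ Q := by positivity
  have e : (k : ℝ) * ((b - a) * (d - c) / 2 ^ 2 * (((b - a) / 2) ^ r) ^ 2 *
      (4 * V ^ 2 / (Real.pi * (r + 1 / 2)) / (k * ((k : ℝ) - r - 1) ^ (2 * r + 1)))) =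
      (b - a) * (d - c) * Q := by
    rw [hQ]; field_simp; ring
  rw [e]
  have : 0 ≤ (b - a) * (d - c) * Q := by positivity
  linarith

theorem singularValue_isBigO (hab : a < b) (hcd : c < d)
    (hK : ContinuousOn (Function.uncurry K) (Icc a b ×ˢ Icc c d))
    (hf : ∀ y ∈ Icc c d, HasDerivOfVariationLE a b V r fun x => K x y) :
    singularValue a b c d K =O[atTop] fun n : ℕ => (n : ℝ) ^ (-((r : ℝ) + 1)) := by
  have h1 : singularValue a b c d K =O[atTop] fun n : ℕ => decayBound r V (n / 2) := by
    refine Asymptotics.IsBigO.of_bound (√((b - a) * (d - c)) / 2 * ((b - a) / 2) ^ r) ?_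
    filter_upwards [eventually_ge_atTop (2 * (r + 2))] with n hn
    have h0 : 0 ≤ singularValue a b c d K n :=
      le_csSup (bddAbove_singularValue_set hK (by omega)) (mem_insert _ _)
    rw [Real.norm_of_nonneg h0, Real.norm_of_nonneg (decayBound_nonneg (by omega) V)]
    exact singularValue_le hab hcd hK hf (by omega) (by omega)
  have h2 := (decayBound_isBigO r V).comp_tendsto (Nat.tendsto_div_const_atTop two_ne_zero)
  refine (h1.trans h2).trans (Asymptotics.IsBigO.of_bound (3 ^ ((r : ℝ) + 1)) ?_)
  filter_upwards [eventually_ge_atTop 2] with n hn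
  have hn0 : (0 : ℝ) < n := by have : 0 < n := by omega
                               positivity
  have h3 : (n : ℝ) / 3 ≤ (n / 2 : ℕ) := by
    rw [div_le_iff₀ (by norm_num)]
    have : n ≤ n / 2 * 3 := by omega
    exact_mod_cast this
  rw [Function.comp, Real.norm_of_nonneg (Real.rpow_nonneg (Nat.cast_nonneg _) _),
    Real.norm_of_nonneg (Real.rpow_nonneg (Nat.cast_nonneg _) _)]
  calc ((n / 2 : ℕ) : ℝ) ^ (-((r : ℝ) + 1)) ≤ ((n : ℝ) / 3) ^ (-((r : ℝ) + 1)) :=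
        Real.rpow_le_rpow_of_nonpos (by positivity) h3 (by have : (0 : ℝ) ≤ r := by positivity
                                                           linarith)
    _ = _ := by
      rw [Real.div_rpow hn0.le (by norm_num), Real.rpow_neg (by norm_num : (0 : ℝ) ≤ 3)]
      field_simp

theorem continuousOn_uncurry_swap (hK : ContinuousOn (Function.uncurry K) (Icc a b ×ˢ Icc c d)) :
    ContinuousOn (Function.uncurry fun y x => K x y) (Icc c d ×ˢ Icc a b) :=
  hK.comp (f := Prod.swap) continuous_swap.continuousOn fun _ hp => ⟨hp.2, hp.1⟩

end

theorem mainTheorem8 (r : ℕ) (V : ℝ≥0) :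
    -- the explicit bound is of order `k ^ (-(r+1))`
    (decayBound r V =O[atTop] fun k : ℕ => (k : ℝ) ^ (-((r : ℝ) + 1))) ∧
    -- kernels on `[-1,1] × [-1,1]`, smooth in `x` uniformly in `y`, or in `y` uniformly in `x`
    (∀ K : ℝ → ℝ → ℝ,
      ContinuousOn (Function.uncurry K) (Icc (-1) 1 ×ˢ Icc (-1) 1) →
      ((∀ y ∈ Icc (-1 : ℝ) 1, HasDerivOfVariationLE (-1) 1 V r (fun x => K x y)) ∨
        (∀ x ∈ Icc (-1 : ℝ) 1, HasDerivOfVariationLE (-1) 1 V r (fun y => K x y))) →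
      (∀ k : ℕ, r + 1 < k → singularValue (-1) 1 (-1) 1 K (2 * k) ≤ decayBound r V k) ∧
      (singularValue (-1) 1 (-1) 1 K =O[atTop] fun n : ℕ => (n : ℝ) ^ (-((r : ℝ) + 1)))) ∧
    -- kernels on a rectangle `[a,b] × [c,d]`
    (∀ (a b c d : ℝ) (K : ℝ → ℝ → ℝ), a < b → c < d →
      ContinuousOn (Function.uncurry K) (Icc a b ×ˢ Icc c d) →
      ((∀ y ∈ Icc c d, HasDerivOfVariationLE a b V r (fun x => K x y)) →
        (∀ k : ℕ, r + 1 < k → singularValue a b c d K (2 * k) ≤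
          √((b - a) * (d - c)) / 2 * ((b - a) / 2) ^ r * decayBound r V k) ∧
        (singularValue a b c d K =O[atTop] fun n : ℕ => (n : ℝ) ^ (-((r : ℝ) + 1)))) ∧
      ((∀ x ∈ Icc a b, HasDerivOfVariationLE c d V r (fun y => K x y)) →
        (∀ k : ℕ, r + 1 < k → singularValue a b c d K (2 * k) ≤
          √((b - a) * (d - c)) / 2 * ((d - c) / 2) ^ r * decayBound r V k) ∧
        (singularValue a b c d K =O[atTop] fun n : ℕ => (n : ℝ) ^ (-((r : ℝ) + 1))))) := by
  have main : ∀ (a b c d : ℝ) (K : ℝ → ℝ → ℝ), a < b → c < d →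
      ContinuousOn (Function.uncurry K) (Icc a b ×ˢ Icc c d) →
      ((∀ y ∈ Icc c d, HasDerivOfVariationLE a b V r (fun x => K x y)) →
        (∀ k : ℕ, r + 1 < k → singularValue a b c d K (2 * k) ≤
          √((b - a) * (d - c)) / 2 * ((b - a) / 2) ^ r * decayBound r V k) ∧
        (singularValue a b c d K =O[atTop] fun n : ℕ => (n : ℝ) ^ (-((r : ℝ) + 1)))) ∧
      ((∀ x ∈ Icc a b, HasDerivOfVariationLE c d V r (fun y => K x y)) →
        (∀ k : ℕ, r + 1 < k → singularValue a b c d K (2 * k) ≤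
          √((b - a) * (d - c)) / 2 * ((d - c) / 2) ^ r * decayBound r V k) ∧
        (singularValue a b c d K =O[atTop] fun n : ℕ => (n : ℝ) ^ (-((r : ℝ) + 1)))) := by
    intro a b c d K hab hcd hK
    refine ⟨fun hf => ⟨fun k hk => singularValue_le hab hcd hK hf hk le_rfl,
      singularValue_isBigO hab hcd hK hf⟩, fun hf => ?_⟩
    rw [singularValue_swap a b c d K, mul_comm (b - a)]
    have hK' := continuousOn_uncurry_swap hK
    exact ⟨fun k hk => singularValue_le hcd hab hK' hf hk le_rfl,
      singularValue_isBigO hcd hab hK' hf⟩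
  refine ⟨decayBound_isBigO r V, fun K hK hf => ?_, main⟩
  have hone : √((1 - -1) * (1 - -1) : ℝ) / 2 * ((1 - -1) / 2) ^ r = 1 := by
    rw [Real.sqrt_mul_self (by norm_num)]
    norm_num
  have h := main (-1) 1 (-1) 1 K (by norm_num) (by norm_num) hK
  simp only [hone, one_mul] at h
  exact hf.elim h.1 h.2
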